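/- Let $-1<q<1$, $S(q)=\left[-\frac{2}{\sqrt{1-q}},\frac{2}{\sqrt{1-q}}\right]$, $(a;q)_n=\prod_{i=0}^{n-1}(1-aq^i)$, $(a;q)_\infty=\prod_{i=0}^{\infty}(1-aq^i)$, and abbreviate $(a)_n=(a;q)_n$, $(a)_\infty=(a;q)_\infty$. Let $[n]_q=1+q+\dots+q^{n-1}$, let $H_n(x|q)$ be the $q$-Hermite polynomials, defined by $H_{-1}=0$, $H_0=1$, $H_{n+1}(x|q)=xH_n(x|q)-[n]_qH_{n-1}(x|q)$, and let $U_n$ be the Chebyshev polynomials of the second kind. Let $$f_U(x|q)=\frac{\sqrt{(1-q)(4-(1-q)x^2)}}{2\pi},\qquad x\in S(q),$$ be the Wigner (semicircle) density of radius $2/\sqrt{1-q}$, and let $$f_N(x|q)=\frac{\sqrt{1-q}\,(q)_\infty}{2\pi\sqrt{4-(1-q)x^2}}\prod_{k=0}^\infty\left((1+q^k)^2-(1-q)x^2q^k\right),\qquad |x|<\frac{2}{\sqrt{1-q}},$$ be the $q$-Normal density. Then the two series $$A(x)=\sum_{k=0}^\infty\frac{q^k(1-q)^{k+1}}{(q)_k(q)_{k+1}}H_{2k}(x|q),\qquad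 B(x)=\sum_{k=0}^\infty(-1)^kq^{k(k+1)/2}\,U_{2k}\!\left(\frac{x\sqrt{1-q}}{2}\right)$$ converge uniformly (and unconditionally) on $S(q)$, and: (1) for $|x|<2/\sqrt{1-q}$, $\quad f_U(x|q)=f_N(x|q)\,A(x)$; (2) for $|x|<2/\sqrt{1-q}$, $\quad f_N(x|q)=f_U(x|q)\,B(x)$, and the expansions (1) and (2) are reciprocal to each other: $A(x)B(x)=1$ for all $x\in S(q)$; (3) for all $x\in S(q)$, $$\prod_{k=1}^\infty\left((1+q^k)^2-(1-q)x^2q^k\right)^{-1}=\sum_{k=0}^\infty\frac{q^k\,(q^{k+1})_\infty\,(1-q)^k}{(q^2)_k}\,H_{2k}(x|q),$$ where the product and the series converge. -/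

import Mathlib

/-- The `q`-number `[n]_q = 1 + q + ... + q^(n-1)`. -/
noncomputable def qNumber (q : ℝ) (n : ℕ) : ℝ := ∑ i ∈ Finset.range n, q ^ i

/-- The finite `q`-Pochhammer symbol `(a; q)_n`. -/
noncomputable def qPoch (a q : ℝ) (n : ℕ) : ℝ := ∏ i ∈ Finset.range n, (1 - a * q ^ i)

/-- The infinite `q`-Pochhammer symbol `(a; q)_∞`. -/
noncomputable def qPochInf (a q : ℝ) : ℝ := ∏' i : ℕ, (1 - a * q ^ i)

/-- The `q`-Hermite polynomials `H_n(x|q)`, given by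
`H_0 = 1`, `H_1 = x`, `H_{n+2} = x H_{n+1} - [n+1]_q H_n`. -/
noncomputable def qHermite (q : ℝ) : ℕ → ℝ → ℝ
  | 0, _ => 1
  | 1, x => x
  | n + 2, x => x * qHermite q (n + 1) x - qNumber q (n + 1) * qHermite q n x

/-- The interval `S(q) = [-2/√(1-q), 2/√(1-q)]`. -/
noncomputable def qSupport (q : ℝ) : Set ℝ :=
  Set.Icc (-(2 / Real.sqrt (1 - q))) (2 / Real.sqrt (1 - q))

/-- The Wigner (semicircle) density of radius `2/√(1-q)`. -/
noncomputable def wignerDensity (q : ℝ) : ℝ → ℝ :=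
  (qSupport q).indicator fun x =>
    Real.sqrt ((1 - q) * (4 - (1 - q) * x ^ 2)) / (2 * Real.pi)

/-- The `q`-Normal density, supported on the open interval `|x| < 2/√(1-q)`. -/
noncomputable def qNormalDensity (q : ℝ) : ℝ → ℝ :=
  (Set.Ioo (-(2 / Real.sqrt (1 - q))) (2 / Real.sqrt (1 - q))).indicator fun x =>
    Real.sqrt (1 - q) * qPochInf q q / (2 * Real.pi * Real.sqrt (4 - (1 - q) * x ^ 2)) *
      ∏' k : ℕ, ((1 + q ^ k) ^ 2 - (1 - q) * x ^ 2 * q ^ k)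

/-- The `k`-th term `q^k (1-q)^(k+1) / ((q)_k (q)_{k+1}) H_{2k}(x|q)`. -/
noncomputable def qHermiteTerm (q : ℝ) (k : ℕ) (x : ℝ) : ℝ :=
  q ^ k * (1 - q) ^ (k + 1) / (qPoch q q k * qPoch q q (k + 1)) * qHermite q (2 * k) x

/-- The `k`-th term `(-1)^k q^(k(k+1)/2) U_{2k}(x√(1-q)/2)`, with `U_n` the Chebyshev
polynomials of the second kind. -/
noncomputable def chebyshevTerm (q : ℝ) (k : ℕ) (x : ℝ) : ℝ :=
  (-1) ^ k * q ^ (k * (k + 1) / 2) *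
    (Polynomial.Chebyshev.U ℝ (2 * (k : ℤ))).eval (x * Real.sqrt (1 - q) / 2)

/-!
Put `y = x√(1-q)/2 ∈ [-1, 1]`, write `U_n` for `U_n(y)`, `A` and `B` for the two series, and
`P = ∏_{k ≥ 1} ((1 + q^k)² - 4 y² q^k)`. Separating the factor `k = 0` of the product in the
`q`-Normal density gives `f_N = f_U · (q)_∞ P` (`qNormalDensity_eq`), so everything follows from
`B = (q)_∞ P` and `A B = 1`.

The first identity (`chebTheta_eq`) is the Jacobi triple product written in the Chebyshev basis.
Its finite form (`prod_eq_sum_jacobiCoeff`)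
`∏_{k=1}^n ((1 + q^k)² - 4 y² q^k) = ∑_{k=0}^n (-1)^k q^(k(k+1)/2) [2n+1, n-k]_q U_{2k}`
is an induction on `n` from `(4y² - 2) U_m = U_{m+2} + U_{m-2}` and the `q`-Pascal rule, and
`n → ∞` is dominated convergence.

For the second identity, `B` times the rescaled `q`-Hermite polynomial has the explicit expansion
(`sqrt_pow_mul_qHermite_mul_chebTheta`)
`(1-q)^(n/2) H_n B = ∑_j (-1)^j q^(j(j+1)/2) (q^(j+1); q)_n U_{n+2j}`,
because the right-hand side satisfies the same three-term recurrence. As `|B|` is bounded below on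
the support by `(q)_∞ P`, this also bounds `(1-q)^(n/2) H_n` by a multiple of `n + 1`, whence the
uniform convergence of `A`. Inserting the expansion into `A B` gives a double series; the coefficient
of `U_{2m}` in it is a finite sum that telescopes to `0` for `m > 0` and is `1` for `m = 0`
(`sum_antidiagonal_recipCoeff`), so `A B = U_0 = 1`.
-/

open Filter Topology

/-! ### Finite `q`-Pochhammer symbols -/

lemma qPoch_zero (a q : ℝ) : qPoch a q 0 = 1 := by simp [qPoch]

lemma qPoch_succ (a q : ℝ) (n : ℕ) :
    qPoch a q (n + 1) = qPoch a q n * (1 - a * q ^ n) :=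
  Finset.prod_range_succ _ _

lemma qPoch_succ' (a q : ℝ) (n : ℕ) :
    qPoch a q (n + 1) = (1 - a) * qPoch (a * q) q n := by
  simp only [qPoch, Finset.prod_range_succ', pow_zero, mul_one, pow_succ']
  rw [mul_comm]
  simp only [mul_assoc]

lemma qPoch_self_succ (q : ℝ) (n : ℕ) :
    qPoch q q (n + 1) = qPoch q q n * (1 - q ^ (n + 1)) := by
  rw [qPoch_succ, pow_succ']

lemma qPoch_self_add (q : ℝ) (j n : ℕ) :
    qPoch q q (n + j) = qPoch q q j * qPoch (q ^ (j + 1)) q n := by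
  induction n with
  | zero => simp [qPoch_zero]
  | succ n ih =>
    rw [show n + 1 + j = n + j + 1 by ring, qPoch_self_succ, ih, qPoch_succ]
    ring

lemma one_sub_pow_succ_ne_zero {q : ℝ} (hq : |q| < 1) (n : ℕ) : 1 - q ^ (n + 1) ≠ 0 := by
  have h : |q ^ (n + 1)| < 1 := by
    rw [abs_pow]; exact pow_lt_one₀ (abs_nonneg q) hq n.succ_ne_zero
  have := (abs_lt.mp h).2
  linarith

lemma qPoch_self_ne_zero {q : ℝ} (hq : |q| < 1) (n : ℕ) : qPoch q q n ≠ 0 := by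
  refine Finset.prod_ne_zero_iff.mpr fun i _ => ?_
  rw [← pow_succ']
  exact one_sub_pow_succ_ne_zero hq i

/-! ### Theta coefficients -/

/-- The coefficient `(-1)^k q^(k(k+1)/2)` of the partial theta series. -/
noncomputable def thetaCoeff (q : ℝ) (k : ℕ) : ℝ := (-1) ^ k * q ^ (k * (k + 1) / 2)

lemma thetaCoeff_zero (q : ℝ) : thetaCoeff q 0 = 1 := by simp [thetaCoeff]

lemma thetaCoeff_succ (q : ℝ) (k : ℕ) :
    thetaCoeff q (k + 1) = -q ^ (k + 1) * thetaCoeff q k := by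
  have h : (k + 1) * (k + 1 + 1) / 2 = k * (k + 1) / 2 + (k + 1) := by
    rw [show (k + 1) * (k + 1 + 1) = k * (k + 1) + (k + 1) * 2 by ring]
    exact Nat.add_mul_div_right _ _ two_pos
  rw [thetaCoeff, thetaCoeff, h, pow_add]
  ring

lemma abs_thetaCoeff_le {q : ℝ} (hq : |q| < 1) (k : ℕ) : |thetaCoeff q k| ≤ |q| ^ k := by
  rw [thetaCoeff, abs_mul, abs_pow, abs_pow, abs_neg, abs_one, one_pow, one_mul]
  refine pow_le_pow_of_le_one (abs_nonneg q) hq.le ?_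
  rw [Nat.le_div_iff_mul_le two_pos]
  rcases k with _ | k
  · simp
  · exact Nat.mul_le_mul_left _ (by omega)

/-! ### Chebyshev polynomials of the second kind -/

/-- The value `U_n(y)` of the Chebyshev polynomial of the second kind. -/
noncomputable def chebU (n : ℕ) (y : ℝ) : ℝ := (Polynomial.Chebyshev.U ℝ (n : ℤ)).eval y

lemma chebU_zero (y : ℝ) : chebU 0 y = 1 := by simp [chebU]

lemma chebU_one (y : ℝ) : chebU 1 y = 2 * y := by simp [chebU]

lemma chebU_add_two (n : ℕ) (y : ℝ) :
    chebU (n + 2) y = 2 * y * chebU (n + 1) y - chebU n y := by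
  simp only [chebU]
  push_cast
  rw [Polynomial.Chebyshev.U_add_two]
  simp

lemma chebU_two (y : ℝ) : chebU 2 y = 4 * y ^ 2 - 1 := by
  have h := chebU_add_two 0 y
  rw [zero_add, zero_add, chebU_zero, chebU_one] at h
  rw [h]
  ring

lemma chebU_add_four (n : ℕ) (y : ℝ) :
    chebU (n + 4) y = (4 * y ^ 2 - 2) * chebU (n + 2) y - chebU n y := by
  have h1 := chebU_add_two n y
  have h2 := chebU_add_two (n + 1) y
  have h3 := chebU_add_two (n + 2) y
  simp only [add_assoc, Nat.reduceAdd] at h1 h2 h3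
  rw [h3, h2]
  linear_combination h1

lemma abs_chebU_le {y : ℝ} (hy : |y| ≤ 1) (n : ℕ) : |chebU n y| ≤ n + 1 := by
  induction n with
  | zero => simp [chebU_zero]
  | succ n ih =>
    have h : chebU (n + 1) y =
        y * chebU n y + (Polynomial.Chebyshev.T ℝ ((n : ℤ) + 1)).eval y := by
      simp only [chebU]
      push_cast
      rw [Polynomial.Chebyshev.U_eq_X_mul_U_add_T]
      simp
    have hT : |(Polynomial.Chebyshev.T ℝ ((n : ℤ) + 1)).eval y| ≤ 1 :=
      Polynomial.Chebyshev.abs_eval_T_real_le_one _ hy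
    have hyU : |y * chebU n y| ≤ 1 * (n + 1) := by
      rw [abs_mul]
      exact mul_le_mul hy ih (abs_nonneg _) zero_le_one
    rw [h]
    push_cast
    linarith [abs_add_le (y * chebU n y) ((Polynomial.Chebyshev.T ℝ ((n : ℤ) + 1)).eval y)]

/-! ### The finite form of the Jacobi triple product -/

/-- The Gaussian binomial coefficient with top entry `a + b` and bottom entry `a`. -/
noncomputable def gaussBinom (q : ℝ) (a b : ℕ) : ℝ :=
  qPoch q q (a + b) / (qPoch q q a * qPoch q q b)

/-- The Gaussian binomial coefficient with top entry `2n+1` and bottom entry `n-k`, taken to be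
zero for `k > n`. -/
noncomputable def jacobiCoeff (q : ℝ) (n k : ℕ) : ℝ :=
  if k ≤ n then gaussBinom q (n - k) (n + 1 + k) else 0

lemma jacobiCoeff_add (q : ℝ) (d k : ℕ) :
    jacobiCoeff q (k + d) k = gaussBinom q d (2 * k + d + 1) := by
  rw [jacobiCoeff, if_pos (by omega)]
  congr 1 <;> omega

lemma jacobiCoeff_of_lt (q : ℝ) {n k : ℕ} (h : n < k) : jacobiCoeff q n k = 0 :=
  if_neg (by omega)

lemma gaussBinom_zero_left {q : ℝ} (hq : |q| < 1) (b : ℕ) : gaussBinom q 0 b = 1 := by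
  rw [gaussBinom, qPoch_zero, one_mul, zero_add, div_self (qPoch_self_ne_zero hq b)]

lemma gaussBinom_one_left {q : ℝ} (hq : |q| < 1) (b : ℕ) :
    gaussBinom q 1 b * (1 - q) = 1 - q ^ (b + 1) := by
  have h1 : 1 - q ≠ 0 := by simpa using one_sub_pow_succ_ne_zero hq 0
  have hb := qPoch_self_ne_zero hq b
  have h : qPoch q q 1 = 1 - q := by simp [qPoch]
  rw [gaussBinom, add_comm 1 b, qPoch_self_succ, h]
  field_simp

/-- Two applications of the `q`-Pascal rule. -/
lemma gaussBinom_add_two_add_two {q : ℝ} (hq : |q| < 1) (a b : ℕ) :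
    gaussBinom q (a + 2) (b + 2) = (1 + q ^ (a + b + 3)) * gaussBinom q (a + 1) (b + 1)
      + q ^ (a + 2) * gaussBinom q (a + 2) b + q ^ (b + 2) * gaussBinom q a (b + 2) := by
  have ha := qPoch_self_ne_zero hq a
  have hb := qPoch_self_ne_zero hq b
  have ha1 := one_sub_pow_succ_ne_zero hq a
  have hb1 := one_sub_pow_succ_ne_zero hq b
  have ha2 := one_sub_pow_succ_ne_zero hq (a + 1)
  have hb2 := one_sub_pow_succ_ne_zero hq (b + 1)
  simp only [gaussBinom]
  rw [show a + 2 + (b + 2) = a + b + 2 + 1 + 1 by ring,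
    show a + 1 + (b + 1) = a + b + 2 by ring, show a + 2 + b = a + b + 2 by ring,
    show a + (b + 2) = a + b + 2 by ring]
  simp only [qPoch_self_succ]
  rw [div_eq_iff (by positivity)]
  field_simp
  ring

/-- The recurrence in `n` for the coefficients of the finite triple product, away from `k = 0`. -/
lemma jacobiCoeff_succ_succ {q : ℝ} (hq : |q| < 1) (n k : ℕ) :
    thetaCoeff q (k + 1) * jacobiCoeff q (n + 1) (k + 1) =
      (1 + q ^ (2 * n + 2)) * (thetaCoeff q (k + 1) * jacobiCoeff q n (k + 1))
      - q ^ (n + 1) * (thetaCoeff q k * jacobiCoeff q n k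
        + thetaCoeff q (k + 2) * jacobiCoeff q n (k + 2)) := by
  rcases lt_or_ge n k with h | h
  · simp only [jacobiCoeff_of_lt q (show n < k by omega),
      jacobiCoeff_of_lt q (show n < k + 1 by omega),
      jacobiCoeff_of_lt q (show n < k + 2 by omega),
      jacobiCoeff_of_lt q (show n + 1 < k + 1 by omega)]
    ring
  obtain ⟨d, rfl⟩ := Nat.exists_eq_add_of_le h
  rw [thetaCoeff_succ q (k + 1), thetaCoeff_succ q k,
    show k + d + 1 = k + 1 + d by ring, jacobiCoeff_add, jacobiCoeff_add]
  rcases d with _ | _ | d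
  · rw [jacobiCoeff_of_lt q (show k + 0 < k + 1 by omega),
      jacobiCoeff_of_lt q (show k + 0 < k + 2 by omega), gaussBinom_zero_left hq,
      gaussBinom_zero_left hq]
    ring
  · have e : jacobiCoeff q (k + (0 + 1)) (k + 1) = 1 := by
      rw [show k + (0 + 1) = k + 1 + 0 by ring, jacobiCoeff_add, gaussBinom_zero_left hq]
    rw [e, jacobiCoeff_of_lt q (show k + (0 + 1) < k + 2 by omega)]
    have h1 : 1 - q ≠ 0 := by simpa using one_sub_pow_succ_ne_zero hq 0
    refine mul_right_cancel₀ h1 ?_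
    have g1 := gaussBinom_one_left hq (2 * (k + 1) + 1 + 1)
    have g2 := gaussBinom_one_left hq (2 * k + 1 + 1)
    simp only [zero_add]
    linear_combination (-q ^ (k + 1) * thetaCoeff q k) * g1 + q ^ (k + 2) * thetaCoeff q k * g2
  · have e1 : jacobiCoeff q (k + (d + 1 + 1)) (k + 1) = gaussBinom q (d + 1) (2 * k + d + 4) := by
      rw [show k + (d + 1 + 1) = k + 1 + (d + 1) by ring, jacobiCoeff_add]
      congr 1; ring
    have e2 : jacobiCoeff q (k + (d + 1 + 1)) (k + 2) = gaussBinom q d (2 * k + d + 5) := by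
      rw [show k + (d + 1 + 1) = k + 2 + d by ring, jacobiCoeff_add]
      congr 1; ring
    have g := gaussBinom_add_two_add_two hq d (2 * k + d + 3)
    rw [e1, e2, show 2 * (k + 1) + (d + 1 + 1) + 1 = 2 * k + d + 3 + 2 by ring,
      show 2 * k + (d + 1 + 1) + 1 = 2 * k + d + 3 by ring, g]
    ring

/-- The recurrence in `n` for the constant coefficient of the finite triple product; the extra term
compared with `jacobiCoeff_succ_succ` reflects `U_{-2} = -U_0`. -/
lemma jacobiCoeff_succ_zero {q : ℝ} (hq : |q| < 1) (n : ℕ) :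
    jacobiCoeff q (n + 1) 0 = (1 + q ^ (2 * n + 2) + q ^ (n + 1)) * jacobiCoeff q n 0
      - q ^ (n + 1) * (thetaCoeff q 1 * jacobiCoeff q n 1) := by
  rw [thetaCoeff_succ q 0, thetaCoeff_zero]
  have e (m : ℕ) : jacobiCoeff q m 0 = gaussBinom q m (m + 1) := by
    simpa using jacobiCoeff_add q m 0
  rw [e, e]
  rcases n with _ | d
  · rw [jacobiCoeff_of_lt q (show 0 < 1 by omega), gaussBinom_zero_left hq]
    have h1 : 1 - q ≠ 0 := by simpa using one_sub_pow_succ_ne_zero hq 0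
    refine mul_right_cancel₀ h1 ?_
    have g := gaussBinom_one_left hq (0 + 1 + 1)
    simp only [zero_add] at g ⊢
    linear_combination g
  · have e1 : jacobiCoeff q (d + 1) 1 = gaussBinom q d (d + 3) := by
      rw [show d + 1 = 1 + d by ring, jacobiCoeff_add]
      congr 1; ring
    have sym : gaussBinom q (d + 2) (d + 1) = gaussBinom q (d + 1) (d + 2) := by
      rw [gaussBinom, gaussBinom, add_comm (d + 2), mul_comm (qPoch q q (d + 2))]
    have g := gaussBinom_add_two_add_two hq d (d + 1)
    rw [e1, show d + 1 + 1 = d + 2 by ring, show d + 2 + 1 = d + 1 + 2 by ring, g, sym]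
    ring

/-- The induction step of the finite triple product, for truncated sums: the coefficient recurrences
leave only a boundary term, which vanishes as soon as `K > n`. -/
lemma sum_range_jacobiCoeff_succ {q : ℝ} (hq : |q| < 1) (y : ℝ) (n K : ℕ) :
    ∑ k ∈ Finset.range (K + 1), thetaCoeff q k * jacobiCoeff q (n + 1) k * chebU (2 * k) y =
      ((1 + q ^ (n + 1)) ^ 2 - 4 * y ^ 2 * q ^ (n + 1)) *
        ∑ k ∈ Finset.range (K + 1), thetaCoeff q k * jacobiCoeff q n k * chebU (2 * k) y
      + q ^ (n + 1) * (thetaCoeff q K * jacobiCoeff q n K * chebU (2 * K + 2) y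
        - thetaCoeff q (K + 1) * jacobiCoeff q n (K + 1) * chebU (2 * K) y) := by
  induction K with
  | zero =>
    have h := jacobiCoeff_succ_zero hq n
    simp only [zero_add, Finset.sum_range_one, thetaCoeff_zero, mul_zero, chebU_zero, chebU_two]
    linear_combination h
  | succ K ih =>
    have h := jacobiCoeff_succ_succ hq n K
    have hU := chebU_add_four (2 * K) y
    rw [Finset.sum_range_succ, ih, Finset.sum_range_succ _ (K + 1), h,
      show 2 * (K + 1) + 2 = 2 * K + 4 by ring, show 2 * (K + 1) = 2 * K + 2 by ring, hU]
    ring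

/-- The finite form of the Jacobi triple product, in the Chebyshev basis. -/
lemma prod_eq_sum_jacobiCoeff {q : ℝ} (hq : |q| < 1) (y : ℝ) (n : ℕ) :
    ∏ k ∈ Finset.range n, ((1 + q ^ (k + 1)) ^ 2 - 4 * y ^ 2 * q ^ (k + 1)) =
      ∑ k ∈ Finset.range (n + 1), thetaCoeff q k * jacobiCoeff q n k * chebU (2 * k) y := by
  induction n with
  | zero => simp [thetaCoeff_zero, chebU_zero, jacobiCoeff, gaussBinom, qPoch_zero,
      div_self (qPoch_self_ne_zero hq 1)]
  | succ n ih =>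
    rw [sum_range_jacobiCoeff_succ hq, Finset.prod_range_succ, ih,
      jacobiCoeff_of_lt q (show n < n + 1 by omega),
      jacobiCoeff_of_lt q (show n < n + 1 + 1 by omega),
      Finset.sum_range_succ _ (n + 1), jacobiCoeff_of_lt q (show n < n + 1 by omega)]
    ring

/-! ### The coefficients of the reciprocal expansions -/

/-- The coefficient of `U_{n+2j}` in the product of the partial theta series with the rescaled
`n`-th `q`-Hermite polynomial. -/
noncomputable def shiftedThetaCoeff (q : ℝ) (n j : ℕ) : ℝ :=
  thetaCoeff q j * qPoch (q ^ (j + 1)) q n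

lemma shiftedThetaCoeff_mul_qPoch (q : ℝ) (n j : ℕ) :
    shiftedThetaCoeff q n j * qPoch q q j = thetaCoeff q j * qPoch q q (n + j) := by
  rw [shiftedThetaCoeff, qPoch_self_add]
  ring

lemma shiftedThetaCoeff_zero_left (q : ℝ) (j : ℕ) : shiftedThetaCoeff q 0 j = thetaCoeff q j := by
  rw [shiftedThetaCoeff, qPoch_zero, mul_one]

/-- The recurrence of the coefficients that matches `H_{n+2} = x H_{n+1} - [n+1]_q H_n`. -/
lemma shiftedThetaCoeff_add_two (q : ℝ) (n j : ℕ) :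
    shiftedThetaCoeff q (n + 2) j = shiftedThetaCoeff q (n + 1) j
      + shiftedThetaCoeff q (n + 1) (j + 1)
      - (1 - q ^ (n + 1)) * shiftedThetaCoeff q n (j + 1) := by
  have h (m : ℕ) : qPoch (q ^ (j + 1)) q (m + 1) = (1 - q ^ (j + 1)) * qPoch (q ^ (j + 2)) q m := by
    rw [qPoch_succ', ← pow_succ]
  simp only [shiftedThetaCoeff, thetaCoeff_succ]
  rw [h, h, qPoch_succ (q ^ (j + 2))]
  ring

lemma shiftedThetaCoeff_succ_zero (q : ℝ) (n : ℕ) :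
    shiftedThetaCoeff q (n + 1) 0 = (1 - q ^ (n + 1)) * shiftedThetaCoeff q n 0 := by
  simp only [shiftedThetaCoeff, zero_add, pow_one, qPoch_self_succ]
  ring

lemma shiftedThetaCoeff_one_left (q : ℝ) (j : ℕ) :
    shiftedThetaCoeff q 1 j = thetaCoeff q j + thetaCoeff q (j + 1) := by
  simp only [shiftedThetaCoeff, thetaCoeff_succ, qPoch_succ, qPoch_zero]
  ring

/-- The coefficient of the rescaled `q`-Hermite polynomial of degree `2k` in the expansion of the
reciprocal of the partial theta series. -/
noncomputable def recipCoeff (q : ℝ) (k : ℕ) : ℝ :=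
  q ^ k * (1 - q) / (qPoch q q k * qPoch q q (k + 1))

/-- One step of the Gosper-type summation in `sum_range_recipCoeff`. -/
lemma recipCoeff_mul_shiftedThetaCoeff_succ {q : ℝ} (hq : |q| < 1) (K d : ℕ) :
    recipCoeff q K * shiftedThetaCoeff q (2 * K) (d + 1) *
        ((1 - q ^ (2 * K + d + 2)) * (1 - q ^ (d + 1))) =
      -(q ^ d * (1 - q ^ (K + 1)) * (1 - q ^ (K + 2))) *
        (recipCoeff q (K + 1) * shiftedThetaCoeff q (2 * (K + 1)) d) := by
  have hd := qPoch_self_ne_zero hq d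
  have hK := qPoch_self_ne_zero hq K
  have hd1 := one_sub_pow_succ_ne_zero hq d
  have hK1 := one_sub_pow_succ_ne_zero hq K
  have hK2 := one_sub_pow_succ_ne_zero hq (K + 1)
  have e1 : shiftedThetaCoeff q (2 * K) (d + 1) =
      -q ^ (d + 1) * thetaCoeff q d * (qPoch q q (2 * K + d) * (1 - q ^ (2 * K + d + 1))) /
        (qPoch q q d * (1 - q ^ (d + 1))) := by
    rw [eq_div_iff (by positivity), ← qPoch_self_succ, ← qPoch_self_succ,
      shiftedThetaCoeff_mul_qPoch, thetaCoeff_succ, ← add_assoc]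
  have e2 : shiftedThetaCoeff q (2 * (K + 1)) d =
      thetaCoeff q d * (qPoch q q (2 * K + d) * (1 - q ^ (2 * K + d + 1))
        * (1 - q ^ (2 * K + d + 2))) / qPoch q q d := by
    rw [eq_div_iff (by positivity), ← qPoch_self_succ, ← qPoch_self_succ,
      shiftedThetaCoeff_mul_qPoch]
    congr 2; ring
  rw [e1, e2, recipCoeff, recipCoeff, qPoch_self_succ q (K + 1), qPoch_self_succ q K]
  field_simp
  ring

/-- The partial sums of the convolution have a closed form, here cleared of its denominators; its
last factor `1 - q^d` vanishes for the complete sum `d = 0`. -/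
lemma sum_range_recipCoeff {q : ℝ} (hq : |q| < 1) (K d : ℕ) :
    (∑ k ∈ Finset.range (K + 1), recipCoeff q k * shiftedThetaCoeff q (2 * k) (K + d - k)) *
        ((1 - q ^ (K + d)) * (1 - q ^ (K + d + 1))) =
      recipCoeff q K * shiftedThetaCoeff q (2 * K) d *
        ((1 - q ^ (2 * K + d + 1)) * (1 - q ^ d)) := by
  induction K generalizing d with
  | zero => simp [mul_comm (1 - q ^ d)]
  | succ K ih =>
    have h := ih (d + 1)
    have hs := recipCoeff_mul_shiftedThetaCoeff_succ hq K d
    rw [show K + 1 + d = K + (d + 1) by ring, Finset.sum_range_succ, add_mul, h,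
      show 2 * K + (d + 1) + 1 = 2 * K + d + 2 by ring, hs,
      show K + (d + 1) - (K + 1) = d by omega]
    ring

/-- The coefficients of the two expansions are inverse to each other. -/
lemma sum_antidiagonal_recipCoeff {q : ℝ} (hq : |q| < 1) (m : ℕ) :
    ∑ p ∈ Finset.HasAntidiagonal.antidiagonal m,
      recipCoeff q p.1 * shiftedThetaCoeff q (2 * p.1) p.2 =
      if m = 0 then 1 else 0 := by
  rw [Finset.Nat.sum_antidiagonal_eq_sum_range_succ
    (fun k j => recipCoeff q k * shiftedThetaCoeff q (2 * k) j)]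
  rcases m with _ | m
  · have h1 : 1 - q ≠ 0 := by simpa using one_sub_pow_succ_ne_zero hq 0
    simp [recipCoeff, shiftedThetaCoeff, thetaCoeff_zero, qPoch, h1]
  · have h := sum_range_recipCoeff hq (m + 1) 0
    rw [pow_zero, sub_self, mul_zero, mul_zero] at h
    rw [if_neg m.succ_ne_zero]
    exact (mul_eq_zero.mp h).resolve_right (mul_ne_zero (one_sub_pow_succ_ne_zero hq m)
      (one_sub_pow_succ_ne_zero hq (m + 1)))

/-! ### Bounds and limits of `q`-Pochhammer symbols -/

lemma abs_qPoch_le {a q : ℝ} (hq : |q| < 1) (ha : |a| ≤ 1) (n : ℕ) :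
    |qPoch a q n| ≤ Real.exp (1 - |q|)⁻¹ := by
  rw [qPoch, Finset.abs_prod]
  calc ∏ i ∈ Finset.range n, |1 - a * q ^ i|
      ≤ ∏ i ∈ Finset.range n, Real.exp (|q| ^ i) := by
        refine Finset.prod_le_prod (fun i _ => abs_nonneg _) fun i _ => ?_
        have h1 : |a * q ^ i| ≤ |q| ^ i := by
          rw [abs_mul, abs_pow]
          exact mul_le_of_le_one_left (by positivity) ha
        have h2 := abs_sub (1 : ℝ) (a * q ^ i)
        rw [abs_one] at h2
        linarith [Real.add_one_le_exp (|q| ^ i)]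
    _ = Real.exp (∑ i ∈ Finset.range n, |q| ^ i) := (Real.exp_sum _ _).symm
    _ ≤ Real.exp (1 - |q|)⁻¹ := by
        refine Real.exp_le_exp.mpr ?_
        rw [← tsum_geometric_of_lt_one (abs_nonneg q) hq]
        exact (summable_geometric_of_lt_one (abs_nonneg q) hq).sum_le_tsum _
          fun i _ => by positivity

lemma summable_norm_neg_self_mul_pow {q : ℝ} (hq : |q| < 1) :
    Summable fun i : ℕ => ‖-(q * q ^ i)‖ := by
  simp only [norm_neg, norm_mul, norm_pow, Real.norm_eq_abs]
  exact (summable_geometric_of_lt_one (abs_nonneg q) hq).mul_left _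

lemma tendsto_qPoch_self {q : ℝ} (hq : |q| < 1) :
    Tendsto (qPoch q q) atTop (𝓝 (qPochInf q q)) := by
  have h := multipliable_one_add_of_summable (summable_norm_neg_self_mul_pow hq)
  simp only [← sub_eq_add_neg] at h
  exact h.hasProd.tendsto_prod_nat

lemma qPochInf_self_ne_zero {q : ℝ} (hq : |q| < 1) : qPochInf q q ≠ 0 := by
  have h := tprod_one_add_ne_zero_of_summable (f := fun i : ℕ => -(q * q ^ i)) (fun i => ?_)
    (summable_norm_neg_self_mul_pow hq)
  · simp only [← sub_eq_add_neg] at h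
    exact h
  · rw [← sub_eq_add_neg, ← pow_succ']
    exact one_sub_pow_succ_ne_zero hq i

lemma exists_pos_le_abs_qPoch_self {q : ℝ} (hq : |q| < 1) :
    ∃ L > 0, ∀ n, L ≤ |qPoch q q n| := by
  have h := (tendsto_qPoch_self hq).inv₀ (qPochInf_self_ne_zero hq)
  obtain ⟨C, hC⟩ := (Metric.isBounded_range_of_tendsto _ h).exists_norm_le
  have hC' (n : ℕ) : |qPoch q q n|⁻¹ ≤ C := by
    rw [← abs_inv]; exact hC _ ⟨n, rfl⟩
  have hpos : 0 < C :=
    (inv_pos.mpr (abs_pos.mpr (qPoch_self_ne_zero hq 0))).trans_le (hC' 0)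
  refine ⟨C⁻¹, inv_pos.mpr hpos, fun n => ?_⟩
  exact inv_le_of_inv_le₀ (abs_pos.mpr (qPoch_self_ne_zero hq n)) (hC' n)

lemma qPochInf_pow_succ {q : ℝ} (hq : |q| < 1) (k : ℕ) :
    qPoch q q k * qPochInf (q ^ (k + 1)) q = qPochInf q q := by
  have h : Multipliable fun i : ℕ => 1 - q * q ^ (i + k) := by
    have hs : Summable fun i : ℕ => ‖-(q * q ^ (i + k))‖ :=
      (summable_norm_neg_self_mul_pow hq).comp_injective (add_left_injective k)
    simpa only [← sub_eq_add_neg] using multipliable_one_add_of_summable hs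
  have e := Multipliable.prod_mul_tprod_nat_mul' (f := fun i : ℕ => 1 - q * q ^ i) h
  rw [qPochInf, qPochInf, qPoch, ← e]
  refine congrArg _ (tprod_congr fun i => ?_)
  ring

/-! ### The product side -/

/-- The infinite product `∏_{k ≥ 1} ((1 + q^k)² - 4 y² q^k)`; with `y = cos θ` its factors are
`(1 - q^k e^{2iθ}) (1 - q^k e^{-2iθ})`. -/
noncomputable def thetaProd (q y : ℝ) : ℝ :=
  ∏' k : ℕ, ((1 + q ^ (k + 1)) ^ 2 - 4 * y ^ 2 * q ^ (k + 1))

lemma multipliable_thetaProd {q : ℝ} (hq : |q| < 1) (y : ℝ) :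
    Multipliable fun k : ℕ => (1 + q ^ (k + 1)) ^ 2 - 4 * y ^ 2 * q ^ (k + 1) := by
  have hs : Summable fun k : ℕ => ‖(2 + q ^ (k + 1) - 4 * y ^ 2) * q ^ (k + 1)‖ := by
    refine Summable.of_nonneg_of_le (fun k => norm_nonneg _) (fun k => ?_)
      ((summable_geometric_of_lt_one (abs_nonneg q) hq).mul_left ((3 + 4 * y ^ 2) * |q|))
    have h1 : |q ^ (k + 1)| ≤ 1 := by
      rw [abs_pow]; exact pow_le_one₀ (abs_nonneg q) hq.le
    have h2 : |2 + q ^ (k + 1) - 4 * y ^ 2| ≤ 3 + 4 * y ^ 2 := by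
      rw [abs_le] at h1 ⊢
      constructor <;> nlinarith [sq_nonneg y]
    rw [Real.norm_eq_abs, abs_mul, abs_pow]
    calc |2 + q ^ (k + 1) - 4 * y ^ 2| * |q| ^ (k + 1)
        ≤ (3 + 4 * y ^ 2) * |q| ^ (k + 1) := by gcongr
      _ = (3 + 4 * y ^ 2) * |q| * |q| ^ k := by ring
  refine (multipliable_one_add_of_summable hs).congr fun k => ?_
  ring

lemma sq_one_sub_abs_le {t y : ℝ} (hy : |y| ≤ 1) :
    (1 - |t|) ^ 2 ≤ (1 + t) ^ 2 - 4 * y ^ 2 * t := by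
  have hy2 : y ^ 2 ≤ 1 := (sq_le_one_iff_abs_le_one y).mpr hy
  rcases abs_cases t with ⟨h, h0⟩ | ⟨h, h0⟩ <;> rw [h] <;> nlinarith [sq_nonneg y]

/-- The product dominates `∏_{k ≥ 1} (1 - |q|^k)²` factor by factor, so it is bounded away from `0`
uniformly in `y ∈ [-1, 1]`. -/
lemma exists_pos_le_thetaProd {q : ℝ} (hq : |q| < 1) :
    ∃ L > 0, ∀ y, |y| ≤ 1 → L ≤ thetaProd q y := by
  have hq' : |(|q|)| < 1 := by rwa [abs_abs]
  obtain ⟨L, hL, h⟩ := exists_pos_le_abs_qPoch_self hq'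
  refine ⟨L ^ 2, by positivity, fun y hy => ?_⟩
  refine ge_of_tendsto' (multipliable_thetaProd hq y).hasProd.tendsto_prod_nat fun n => ?_
  calc L ^ 2 ≤ |qPoch |q| |q| n| ^ 2 := by gcongr; exact h n
    _ = ∏ k ∈ Finset.range n, (1 - |q ^ (k + 1)|) ^ 2 := by
      rw [sq_abs, qPoch, ← Finset.prod_pow]
      refine Finset.prod_congr rfl fun k _ => ?_
      rw [abs_pow, pow_succ' |q|]
    _ ≤ _ := by
      refine Finset.prod_le_prod (fun k _ => sq_nonneg _) fun k _ => sq_one_sub_abs_le hy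

/-! ### The triple product identity -/

/-- The partial theta series `∑ (-1)^k q^(k(k+1)/2) U_{2k}(y)`. -/
noncomputable def chebTheta (q y : ℝ) : ℝ := ∑' k : ℕ, thetaCoeff q k * chebU (2 * k) y

lemma summable_pow_mul_two_mul_add_one {q : ℝ} (hq : |q| < 1) :
    Summable fun k : ℕ => |q| ^ k * (2 * k + 1) := by
  have h1 : Summable fun k : ℕ => (k : ℝ) * |q| ^ k := by
    simpa using summable_pow_mul_geometric_of_norm_lt_one 1 (r := |q|) (by simpa using hq)
  refine ((h1.mul_left 2).add (summable_geometric_of_lt_one (abs_nonneg q) hq)).congr fun k => ?_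
  ring

lemma exists_abs_jacobiCoeff_le {q : ℝ} (hq : |q| < 1) :
    ∃ C, ∀ n k, |jacobiCoeff q n k| ≤ C := by
  obtain ⟨L, hL, h⟩ := exists_pos_le_abs_qPoch_self hq
  refine ⟨Real.exp (1 - |q|)⁻¹ / (L * L), fun n k => ?_⟩
  rw [jacobiCoeff]
  split_ifs
  · rw [gaussBinom, abs_div, abs_mul]
    gcongr
    · exact abs_qPoch_le hq hq.le _
    · exact h _
    · exact h _
  · rw [abs_zero]; positivity

lemma tendsto_jacobiCoeff {q : ℝ} (hq : |q| < 1) (k : ℕ) :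
    Tendsto (fun n => jacobiCoeff q n k) atTop (𝓝 (qPochInf q q)⁻¹) := by
  have h := tendsto_qPoch_self hq
  have h0 := qPochInf_self_ne_zero hq
  have h1 : Tendsto (fun d => jacobiCoeff q (d + k) k) atTop
      (𝓝 (qPochInf q q / (qPochInf q q * qPochInf q q))) := by
    simp only [add_comm _ k, jacobiCoeff_add, gaussBinom]
    refine (h.comp ?_).div (h.mul (h.comp ?_)) (mul_ne_zero h0 h0)
    · exact tendsto_atTop_mono (fun d => show d ≤ d + (2 * k + d + 1) by omega) tendsto_id
    · exact tendsto_atTop_mono (fun d => show d ≤ 2 * k + d + 1 by omega) tendsto_id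
  rw [div_mul_cancel_left₀ h0] at h1
  exact (tendsto_add_atTop_iff_nat k).mp h1

/-- The Jacobi triple product identity, in the Chebyshev basis. -/
lemma chebTheta_eq {q : ℝ} (hq : |q| < 1) {y : ℝ} (hy : |y| ≤ 1) :
    chebTheta q y = qPochInf q q * thetaProd q y := by
  obtain ⟨C, hC⟩ := exists_abs_jacobiCoeff_le hq
  have h1 : Tendsto (fun n => ∑' k : ℕ, thetaCoeff q k * jacobiCoeff q n k * chebU (2 * k) y)
      atTop (𝓝 (∑' k : ℕ, thetaCoeff q k * (qPochInf q q)⁻¹ * chebU (2 * k) y)) := by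
    refine tendsto_tsum_of_dominated_convergence
      ((summable_pow_mul_two_mul_add_one hq).mul_left C)
      (fun k => ((tendsto_jacobiCoeff hq k).const_mul _).mul_const _)
      (Eventually.of_forall fun n k => ?_)
    have hU := abs_chebU_le hy (2 * k)
    push_cast at hU
    have hC0 : 0 ≤ C := (abs_nonneg _).trans (hC n k)
    calc ‖thetaCoeff q k * jacobiCoeff q n k * chebU (2 * k) y‖
        = |jacobiCoeff q n k| * (|thetaCoeff q k| * |chebU (2 * k) y|) := by
          rw [Real.norm_eq_abs, abs_mul, abs_mul]; ring
      _ ≤ C * (|q| ^ k * (2 * k + 1)) := by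
          gcongr
          · exact hC n k
          · exact abs_thetaCoeff_le hq k
  have h2 : (fun n => ∑' k : ℕ, thetaCoeff q k * jacobiCoeff q n k * chebU (2 * k) y) =
      fun n => ∏ k ∈ Finset.range n, ((1 + q ^ (k + 1)) ^ 2 - 4 * y ^ 2 * q ^ (k + 1)) := by
    funext n
    rw [prod_eq_sum_jacobiCoeff hq]
    refine tsum_eq_sum fun k hk => ?_
    rw [jacobiCoeff_of_lt q (by simpa using hk)]
    ring
  rw [h2] at h1
  have h3 := tendsto_nhds_unique h1 (multipliable_thetaProd hq y).hasProd.tendsto_prod_nat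
  rw [thetaProd, ← h3, ← tsum_mul_left, chebTheta]
  refine tsum_congr fun k => ?_
  have h0 := qPochInf_self_ne_zero hq
  field_simp

lemma exists_pos_le_abs_chebTheta {q : ℝ} (hq : |q| < 1) :
    ∃ L > 0, ∀ y, |y| ≤ 1 → L ≤ |chebTheta q y| := by
  obtain ⟨L, hL, h⟩ := exists_pos_le_thetaProd hq
  have h0 := abs_pos.mpr (qPochInf_self_ne_zero hq)
  refine ⟨|qPochInf q q| * L, by positivity, fun y hy => ?_⟩
  rw [chebTheta_eq hq hy, abs_mul]
  gcongr
  exact (h y hy).trans (le_abs_self _)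

/-! ### Multiplying the theta series by a `q`-Hermite polynomial -/

lemma abs_shiftedThetaCoeff_le {q : ℝ} (hq : |q| < 1) (n j : ℕ) :
    |shiftedThetaCoeff q n j| ≤ Real.exp (1 - |q|)⁻¹ * |q| ^ j := by
  rw [shiftedThetaCoeff, abs_mul, mul_comm]
  gcongr
  · refine abs_qPoch_le hq ?_ n
    rw [abs_pow]; exact pow_le_one₀ (abs_nonneg q) hq.le
  · exact abs_thetaCoeff_le hq j

/-- A bound that separates the two summation variables. -/
lemma abs_shiftedThetaCoeff_mul_chebU_le {q : ℝ} (hq : |q| < 1) {y : ℝ} (hy : |y| ≤ 1)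
    (n m j : ℕ) :
    |shiftedThetaCoeff q n j * chebU (m + 2 * j) y| ≤
      (m + 1) * (Real.exp (1 - |q|)⁻¹ * (|q| ^ j * (2 * j + 1))) := by
  have hU : |chebU (m + 2 * j) y| ≤ (m + 1) * (2 * j + 1) := by
    refine (abs_chebU_le hy _).trans ?_
    push_cast
    nlinarith [mul_nonneg (Nat.cast_nonneg (α := ℝ) m) (Nat.cast_nonneg (α := ℝ) j)]
  calc |shiftedThetaCoeff q n j * chebU (m + 2 * j) y|
      ≤ (Real.exp (1 - |q|)⁻¹ * |q| ^ j) * ((m + 1) * (2 * j + 1)) := by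
        rw [abs_mul]
        gcongr
        exact abs_shiftedThetaCoeff_le hq n j
    _ = _ := by ring

lemma summable_shiftedThetaCoeff_mul_chebU {q : ℝ} (hq : |q| < 1) {y : ℝ} (hy : |y| ≤ 1)
    (n m : ℕ) : Summable fun j : ℕ => shiftedThetaCoeff q n j * chebU (m + 2 * j) y :=
  (((summable_pow_mul_two_mul_add_one hq).mul_left _).mul_left _).of_norm_bounded
    (abs_shiftedThetaCoeff_mul_chebU_le hq hy n m)

/-- The series `∑ⱼ (-1)^j q^(j(j+1)/2) (q^(j+1); q)_n U_{n+2j}(y)`. -/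
noncomputable def shiftedTheta (q : ℝ) (n : ℕ) (y : ℝ) : ℝ :=
  ∑' j : ℕ, shiftedThetaCoeff q n j * chebU (n + 2 * j) y

lemma shiftedTheta_zero (q y : ℝ) : shiftedTheta q 0 y = chebTheta q y := by
  simp only [shiftedTheta, chebTheta, shiftedThetaCoeff_zero_left, zero_add]

lemma shiftedTheta_one {q : ℝ} (hq : |q| < 1) {y : ℝ} (hy : |y| ≤ 1) :
    shiftedTheta q 1 y = 2 * y * chebTheta q y := by
  have s0 := summable_shiftedThetaCoeff_mul_chebU hq hy 0 0
  have s1 := summable_shiftedThetaCoeff_mul_chebU hq hy 0 1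
  have s2 : Summable fun j : ℕ => thetaCoeff q (j + 1) * chebU (1 + 2 * j) y := by
    refine ((summable_shiftedThetaCoeff_mul_chebU hq hy 1 1).sub s1).congr fun j => ?_
    rw [shiftedThetaCoeff_one_left, shiftedThetaCoeff_zero_left]
    ring
  simp only [shiftedThetaCoeff_zero_left, zero_add] at s0 s1
  have e : shiftedTheta q 1 y = ∑' j : ℕ, thetaCoeff q j * chebU (1 + 2 * j) y
      + ∑' j : ℕ, thetaCoeff q (j + 1) * chebU (1 + 2 * j) y := by
    rw [shiftedTheta, ← s1.tsum_add s2]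
    refine tsum_congr fun j => ?_
    rw [shiftedThetaCoeff_one_left, add_mul]
  rw [e, s1.tsum_eq_zero_add, chebTheta, s0.tsum_eq_zero_add, add_assoc,
    ← ((summable_nat_add_iff 1).mpr s1).tsum_add s2, mul_add, ← tsum_mul_left]
  congr 1
  · simp [chebU_zero, chebU_one, thetaCoeff_zero]
  · refine tsum_congr fun j => ?_
    have hU := chebU_add_two (1 + 2 * j) y
    rw [show 1 + 2 * (j + 1) = 1 + 2 * j + 2 by ring, show 2 * (j + 1) = 1 + 2 * j + 1 by ring]
    linear_combination thetaCoeff q (j + 1) * hU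

lemma shiftedTheta_add_two {q : ℝ} (hq : |q| < 1) {y : ℝ} (hy : |y| ≤ 1) (n : ℕ) :
    shiftedTheta q (n + 2) y =
      2 * y * shiftedTheta q (n + 1) y - (1 - q ^ (n + 1)) * shiftedTheta q n y := by
  have s1 := summable_shiftedThetaCoeff_mul_chebU hq hy (n + 1) (n + 1)
  have s2 := summable_shiftedThetaCoeff_mul_chebU hq hy (n + 1) (n + 2)
  have s3 := summable_shiftedThetaCoeff_mul_chebU hq hy (n + 1) n
  have s4 := summable_shiftedThetaCoeff_mul_chebU hq hy n n
  -- The terms with `U_n` cancel, so the last two series may be shifted by one.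
  have e : 2 * y * shiftedTheta q (n + 1) y - (1 - q ^ (n + 1)) * shiftedTheta q n y =
      ∑' j : ℕ, shiftedThetaCoeff q (n + 1) j * chebU (n + 2 + 2 * j) y
      + ∑' j : ℕ, (shiftedThetaCoeff q (n + 1) j * chebU (n + 2 * j) y
        - (1 - q ^ (n + 1)) * (shiftedThetaCoeff q n j * chebU (n + 2 * j) y)) := by
    rw [shiftedTheta, shiftedTheta, ← tsum_mul_left, ← tsum_mul_left,
      ← (s1.mul_left _).tsum_sub (s4.mul_left _), ← s2.tsum_add (s3.sub (s4.mul_left _))]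
    refine tsum_congr fun j => ?_
    have hU := chebU_add_two (n + 2 * j) y
    rw [show n + 2 + 2 * j = n + 2 * j + 2 by ring, show n + 1 + 2 * j = n + 2 * j + 1 by ring]
    linear_combination -shiftedThetaCoeff q (n + 1) j * hU
  have s5 := s3.sub (s4.mul_left (1 - q ^ (n + 1)))
  rw [e, s5.tsum_eq_zero_add, shiftedThetaCoeff_succ_zero,
    ← mul_assoc, sub_self, zero_add, ← s2.tsum_add ((summable_nat_add_iff 1).mpr s5), shiftedTheta]
  refine tsum_congr fun j => ?_
  rw [shiftedThetaCoeff_add_two, show n + 2 * (j + 1) = n + 2 + 2 * j by ring]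
  ring

/-! ### The `q`-Hermite polynomials on the support -/

lemma one_sub_mul_qNumber (q : ℝ) (n : ℕ) : (1 - q) * qNumber q n = 1 - q ^ n := by
  rw [qNumber, mul_comm, geom_sum_mul_neg]

/-- Both sides satisfy the three-term recurrence of the `q`-Hermite polynomials. -/
lemma sqrt_pow_mul_qHermite_mul_chebTheta {q : ℝ} (hq : |q| < 1) {x : ℝ}
    (hy : |x * √(1 - q) / 2| ≤ 1) (n : ℕ) :
    √(1 - q) ^ n * qHermite q n x * chebTheta q (x * √(1 - q) / 2) =
      shiftedTheta q n (x * √(1 - q) / 2) := by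
  induction n using Nat.twoStepInduction with
  | zero => simp [qHermite, shiftedTheta_zero]
  | one =>
    rw [shiftedTheta_one hq hy, qHermite]
    ring
  | more n ih0 ih1 =>
    have hs : √(1 - q) ^ 2 = 1 - q := Real.sq_sqrt (by linarith [(abs_lt.mp hq).2])
    have hn := one_sub_mul_qNumber q (n + 1)
    rw [shiftedTheta_add_two hq hy, ← ih0, ← ih1, qHermite, ← hn]
    linear_combination (-(√(1 - q) ^ n * qNumber q (n + 1) * qHermite q n x *
      chebTheta q (x * √(1 - q) / 2))) * hs

lemma abs_mul_sqrt_div_two_le_one {q : ℝ} (hq : |q| < 1) {x : ℝ} (hx : x ∈ qSupport q) :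
    |x * √(1 - q) / 2| ≤ 1 := by
  have hs : 0 < √(1 - q) := Real.sqrt_pos.mpr (by linarith [(abs_lt.mp hq).2])
  have h : |x| * √(1 - q) ≤ 2 := (le_div_iff₀ hs).mp (abs_le.mpr hx)
  rw [abs_div, abs_mul, abs_of_pos hs, abs_two]
  linarith

/-- The lower bound for the theta series makes the rescaled `q`-Hermite polynomials grow at most
linearly in the degree, uniformly on the support. -/
lemma exists_abs_qHermite_le {q : ℝ} (hq : |q| < 1) :
    ∃ C, ∀ n, ∀ x ∈ qSupport q, |√(1 - q) ^ n * qHermite q n x| ≤ C * (n + 1) := by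
  obtain ⟨L, hL, h⟩ := exists_pos_le_abs_chebTheta hq
  have hs := summable_pow_mul_two_mul_add_one hq
  set S := ∑' j : ℕ, |q| ^ j * (2 * (j : ℝ) + 1)
  refine ⟨Real.exp (1 - |q|)⁻¹ * S / L, fun n x hx => ?_⟩
  have hy := abs_mul_sqrt_div_two_le_one hq hx
  have h1 : |shiftedTheta q n (x * √(1 - q) / 2)| ≤ (n + 1) * (Real.exp (1 - |q|)⁻¹ * S) := by
    exact tsum_of_norm_bounded ((hs.hasSum.mul_left _).mul_left _)
      fun j => (Real.norm_eq_abs _).trans_le (abs_shiftedThetaCoeff_mul_chebU_le hq hy n n j)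
  rw [← sqrt_pow_mul_qHermite_mul_chebTheta hq hy, abs_mul] at h1
  rw [div_mul_eq_mul_div, le_div_iff₀ hL]
  calc |√(1 - q) ^ n * qHermite q n x| * L
      ≤ |√(1 - q) ^ n * qHermite q n x| * |chebTheta q (x * √(1 - q) / 2)| := by
        gcongr
        exact h _ hy
    _ ≤ _ := by linarith

lemma exists_abs_recipCoeff_le {q : ℝ} (hq : |q| < 1) :
    ∃ C, ∀ k, |recipCoeff q k| ≤ C * |q| ^ k := by
  obtain ⟨L, hL, h⟩ := exists_pos_le_abs_qPoch_self hq
  refine ⟨|1 - q| / (L * L), fun k => ?_⟩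
  rw [recipCoeff, abs_div, abs_mul, abs_mul, abs_pow, div_mul_eq_mul_div, mul_comm (|1 - q|)]
  gcongr
  · exact h _
  · exact h _

lemma qHermiteTerm_eq {q : ℝ} (hq : |q| < 1) (k : ℕ) (x : ℝ) :
    qHermiteTerm q k x = recipCoeff q k * (√(1 - q) ^ (2 * k) * qHermite q (2 * k) x) := by
  rw [qHermiteTerm, recipCoeff, pow_mul, Real.sq_sqrt (by linarith [(abs_lt.mp hq).2])]
  ring

lemma chebyshevTerm_eq (q : ℝ) (k : ℕ) (x : ℝ) :
    chebyshevTerm q k x = thetaCoeff q k * chebU (2 * k) (x * √(1 - q) / 2) := by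
  rw [chebyshevTerm, thetaCoeff, chebU]
  push_cast
  rfl

lemma summableUniformlyOn_qHermiteTerm {q : ℝ} (hq : |q| < 1) :
    SummableUniformlyOn (qHermiteTerm q) (qSupport q) := by
  obtain ⟨C, hC⟩ := exists_abs_recipCoeff_le hq
  obtain ⟨D, hD⟩ := exists_abs_qHermite_le hq
  refine (HasSumUniformlyOn.of_norm_le_summable
    ((summable_pow_mul_two_mul_add_one hq).mul_left (C * D))
    fun k x hx => ?_).summableUniformlyOn
  have h := hD (2 * k) x hx
  push_cast at h
  calc ‖qHermiteTerm q k x‖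
      = |recipCoeff q k| * |√(1 - q) ^ (2 * k) * qHermite q (2 * k) x| := by
        rw [qHermiteTerm_eq hq, Real.norm_eq_abs, abs_mul]
    _ ≤ (C * |q| ^ k) * (D * (2 * k + 1)) :=
        mul_le_mul (hC k) h (abs_nonneg _) ((abs_nonneg _).trans (hC k))
    _ = C * D * (|q| ^ k * (2 * k + 1)) := by ring

lemma summableUniformlyOn_chebyshevTerm {q : ℝ} (hq : |q| < 1) :
    SummableUniformlyOn (chebyshevTerm q) (qSupport q) := by
  refine (HasSumUniformlyOn.of_norm_le_summable (summable_pow_mul_two_mul_add_one hq)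
    fun k x hx => ?_).summableUniformlyOn
  have hU := abs_chebU_le (abs_mul_sqrt_div_two_le_one hq hx) (2 * k)
  push_cast at hU
  rw [chebyshevTerm_eq, Real.norm_eq_abs, abs_mul]
  gcongr
  exact abs_thetaCoeff_le hq k

lemma tsum_chebyshevTerm (q x : ℝ) :
    ∑' k : ℕ, chebyshevTerm q k x = chebTheta q (x * √(1 - q) / 2) :=
  tsum_congr fun k => chebyshevTerm_eq q k x

/-! ### Reciprocity -/

/-- Expanding the products `recipCoeff * shiftedTheta` into a double series over `(k, j)`, the
Chebyshev polynomial `U_{2k+2j}` is constant on antidiagonals, where the coefficients add up to `0`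
except for `U_0`. -/
lemma tsum_recipCoeff_mul_shiftedTheta {q : ℝ} (hq : |q| < 1) {y : ℝ} (hy : |y| ≤ 1) :
    ∑' k : ℕ, recipCoeff q k * shiftedTheta q (2 * k) y = 1 := by
  obtain ⟨C, hC⟩ := exists_abs_recipCoeff_le hq
  let F : ℕ × ℕ → ℝ := fun p =>
    recipCoeff q p.1 * (shiftedThetaCoeff q (2 * p.1) p.2 * chebU (2 * p.1 + 2 * p.2) y)
  have hs := summable_pow_mul_two_mul_add_one hq
  have hF : Summable F := by
    refine ((hs.mul_left C).mul_of_nonneg (hs.mul_left (Real.exp (1 - |q|)⁻¹)) ?_ ?_).of_norm_bounded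
      fun p => ?_
    · intro k
      have : 0 ≤ C * |q| ^ k := (abs_nonneg _).trans (hC k)
      show 0 ≤ C * (|q| ^ k * (2 * k + 1))
      rw [← mul_assoc]
      positivity
    · intro j
      show 0 ≤ Real.exp (1 - |q|)⁻¹ * (|q| ^ j * (2 * j + 1))
      positivity
    · have h := abs_shiftedThetaCoeff_mul_chebU_le hq hy (2 * p.1) (2 * p.1) p.2
      push_cast at h
      calc ‖F p‖ = |recipCoeff q p.1| *
            |shiftedThetaCoeff q (2 * p.1) p.2 * chebU (2 * p.1 + 2 * p.2) y| := by
            rw [Real.norm_eq_abs, abs_mul]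
        _ ≤ (C * |q| ^ p.1) * ((2 * p.1 + 1) *
              (Real.exp (1 - |q|)⁻¹ * (|q| ^ p.2 * (2 * p.2 + 1)))) :=
            mul_le_mul (hC _) h (abs_nonneg _) ((abs_nonneg _).trans (hC _))
        _ = _ := by ring
  have h1 : ∑' p, F p = ∑' k : ℕ, recipCoeff q k * shiftedTheta q (2 * k) y := by
    rw [hF.tsum_prod]
    refine tsum_congr fun k => ?_
    rw [shiftedTheta, ← tsum_mul_left]
  have h2 : ∑' p, F p = ∑' m : ℕ, ∑ p ∈ Finset.HasAntidiagonal.antidiagonal m, F p := by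
    have hσ : Summable fun c : Σ n : ℕ, Finset.HasAntidiagonal.antidiagonal n => F c.2 :=
      Finset.HasAntidiagonal.sigmaAntidiagonalEquivProd.summable_iff.mpr hF
    rw [← Finset.HasAntidiagonal.sigmaAntidiagonalEquivProd.tsum_eq F]
    refine (hσ.tsum_sigma' fun m => (hasSum_fintype _).summable).trans ?_
    refine tsum_congr fun m => ?_
    rw [tsum_fintype]
    exact Finset.sum_coe_sort _ F
  have h3 (m : ℕ) : ∑ p ∈ Finset.HasAntidiagonal.antidiagonal m, F p =
      (if m = 0 then 1 else 0) * chebU (2 * m) y := by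
    rw [← sum_antidiagonal_recipCoeff hq m, Finset.sum_mul]
    refine Finset.sum_congr rfl fun p hp => ?_
    rw [← Finset.HasAntidiagonal.mem_antidiagonal.mp hp, mul_add, mul_assoc]
  rw [← h1, h2, tsum_congr h3, tsum_eq_single 0 fun m hm => by simp [hm]]
  simp [chebU_zero]

lemma tsum_qHermiteTerm_mul_chebTheta {q : ℝ} (hq : |q| < 1) {x : ℝ} (hx : x ∈ qSupport q) :
    (∑' k : ℕ, qHermiteTerm q k x) * chebTheta q (x * √(1 - q) / 2) = 1 := by
  have hy := abs_mul_sqrt_div_two_le_one hq hx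
  refine Eq.trans ?_ (tsum_recipCoeff_mul_shiftedTheta hq hy)
  rw [← tsum_mul_right]
  refine tsum_congr fun k => ?_
  rw [qHermiteTerm_eq hq, mul_assoc, sqrt_pow_mul_qHermite_mul_chebTheta hq hy]

/-! ### The densities -/

lemma four_mul_sq_mul_sqrt {q : ℝ} (hq : |q| < 1) (x : ℝ) :
    4 * (x * √(1 - q) / 2) ^ 2 = (1 - q) * x ^ 2 := by
  rw [div_pow, mul_pow, Real.sq_sqrt (by linarith [(abs_lt.mp hq).2])]
  ring

lemma thetaProd_eq {q : ℝ} (hq : |q| < 1) (x : ℝ) :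
    thetaProd q (x * √(1 - q) / 2) =
      ∏' k : ℕ, ((1 + q ^ (k + 1)) ^ 2 - (1 - q) * x ^ 2 * q ^ (k + 1)) := by
  simp only [thetaProd, four_mul_sq_mul_sqrt hq]

/-- The factor `k = 0` of the product in the `q`-Normal density turns its singular weight into the
semicircle. -/
lemma qNormalDensity_eq {q : ℝ} (hq : |q| < 1) {x : ℝ} (hx : |x| < 2 / √(1 - q)) :
    qNormalDensity q x = wignerDensity q x * chebTheta q (x * √(1 - q) / 2) := by
  have hq1 : 0 < 1 - q := by linarith [(abs_lt.mp hq).2]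
  have hx' : x ∈ Set.Ioo (-(2 / √(1 - q))) (2 / √(1 - q)) := abs_lt.mp hx
  have hxS : x ∈ qSupport q := Set.Ioo_subset_Icc_self hx'
  have hw : 0 < 4 - (1 - q) * x ^ 2 := by
    have h : |x| * √(1 - q) < 2 := (lt_div_iff₀ (Real.sqrt_pos.mpr hq1)).mp hx
    have h2 : (|x| * √(1 - q)) ^ 2 < 2 ^ 2 := by gcongr
    rw [mul_pow, sq_abs, Real.sq_sqrt hq1.le] at h2
    linarith
  have hm : Multipliable fun k : ℕ =>
      (1 + q ^ (k + 1)) ^ 2 - (1 - q) * x ^ 2 * q ^ (k + 1) := by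
    simpa only [four_mul_sq_mul_sqrt hq] using multipliable_thetaProd hq (x * √(1 - q) / 2)
  have hp : ∏' k : ℕ, ((1 + q ^ k) ^ 2 - (1 - q) * x ^ 2 * q ^ k) =
      (4 - (1 - q) * x ^ 2) * thetaProd q (x * √(1 - q) / 2) := by
    rw [tprod_eq_zero_mul' (f := fun k : ℕ => (1 + q ^ k) ^ 2 - (1 - q) * x ^ 2 * q ^ k) hm,
      thetaProd_eq hq]
    congr 1
    ring
  have hw2 := Real.mul_self_sqrt hw.le
  have hw0 := (Real.sqrt_pos.mpr hw).ne'
  rw [qNormalDensity, wignerDensity, Set.indicator_of_mem hx', Set.indicator_of_mem hxS, hp,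
    chebTheta_eq hq (abs_mul_sqrt_div_two_le_one hq hxS), Real.sqrt_mul hq1.le]
  have hpi := Real.pi_ne_zero
  generalize thetaProd q (x * √(1 - q) / 2) = P
  field_simp
  linear_combination (-qPochInf q q * P) * hw2

lemma qPoch_sq_mul (q : ℝ) (k : ℕ) : (1 - q) * qPoch (q ^ 2) q k = qPoch q q (k + 1) := by
  rw [qPoch_succ', sq]

lemma productSeriesTerm_eq {q : ℝ} (hq : |q| < 1) (k : ℕ) (x : ℝ) :
    q ^ k * qPochInf (q ^ (k + 1)) q * (1 - q) ^ k / qPoch (q ^ 2) q k * qHermite q (2 * k) x =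
      qPochInf q q * qHermiteTerm q k x := by
  have h1 : 1 - q ≠ 0 := by simpa using one_sub_pow_succ_ne_zero hq 0
  have hk := qPoch_self_ne_zero hq k
  have hk2 : qPoch (q ^ 2) q k ≠ 0 :=
    right_ne_zero_of_mul ((qPoch_sq_mul q k).trans_ne (qPoch_self_ne_zero hq (k + 1)))
  rw [qHermiteTerm, ← qPoch_sq_mul, ← qPochInf_pow_succ hq k]
  field_simp
  ring

theorem mainTheorem4 (q : ℝ) (hq : |q| < 1) :
    -- both series converge, uniformly on `S(q)`
    SummableUniformlyOn (qHermiteTerm q) (qSupport q) ∧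
    SummableUniformlyOn (chebyshevTerm q) (qSupport q) ∧
    -- the expansion of the Wigner density in the `q`-Normal density
    (∀ x : ℝ, |x| < 2 / Real.sqrt (1 - q) →
      wignerDensity q x = qNormalDensity q x * ∑' k : ℕ, qHermiteTerm q k x) ∧
    -- the expansion of the `q`-Normal density in the Wigner density, and reciprocity
    (∀ x : ℝ, |x| < 2 / Real.sqrt (1 - q) →
      qNormalDensity q x = wignerDensity q x * ∑' k : ℕ, chebyshevTerm q k x) ∧
    (∀ x ∈ qSupport q, (∑' k : ℕ, qHermiteTerm q k x) * (∑' k : ℕ, chebyshevTerm q k x) = 1) ∧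
    -- the product identity
    (∀ x ∈ qSupport q,
      Multipliable (fun k : ℕ =>
        ((1 + q ^ (k + 1)) ^ 2 - (1 - q) * x ^ 2 * q ^ (k + 1))⁻¹) ∧
      HasSum (fun k : ℕ =>
          q ^ k * qPochInf (q ^ (k + 1)) q * (1 - q) ^ k / qPoch (q ^ 2) q k *
            qHermite q (2 * k) x)
        (∏' k : ℕ, ((1 + q ^ (k + 1)) ^ 2 - (1 - q) * x ^ 2 * q ^ (k + 1))⁻¹)) := by
  have hA := summableUniformlyOn_qHermiteTerm hq
  refine ⟨hA, summableUniformlyOn_chebyshevTerm hq, fun x hx => ?_, fun x hx => ?_,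
    fun x hx => ?_, fun x hx => ?_⟩
  · have hxS : x ∈ qSupport q := Set.Ioo_subset_Icc_self (abs_lt.mp hx)
    rw [qNormalDensity_eq hq hx, mul_assoc, mul_comm (chebTheta _ _),
      tsum_qHermiteTerm_mul_chebTheta hq hxS, mul_one]
  · rw [tsum_chebyshevTerm, qNormalDensity_eq hq hx]
  · rw [tsum_chebyshevTerm, tsum_qHermiteTerm_mul_chebTheta hq hx]
  · have hAB := tsum_qHermiteTerm_mul_chebTheta hq hx
    rw [chebTheta_eq hq (abs_mul_sqrt_div_two_le_one hq hx), thetaProd_eq hq] at hAB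
    have hm : Multipliable fun k : ℕ =>
        (1 + q ^ (k + 1)) ^ 2 - (1 - q) * x ^ 2 * q ^ (k + 1) := by
      simpa only [four_mul_sq_mul_sqrt hq] using multipliable_thetaProd hq (x * √(1 - q) / 2)
    have h0 := right_ne_zero_of_mul (right_ne_zero_of_mul (hAB.trans_ne one_ne_zero))
    have hinv := hm.hasProd.inv₀ h0
    refine ⟨hinv.multipliable, ?_⟩
    have hs := (hA.summable hx).hasSum.mul_left (qPochInf q q)
    rw [eq_inv_of_mul_eq_one_left (a := qPochInf q q * ∑' k : ℕ, qHermiteTerm q k x)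
      (b := ∏' k : ℕ,
      ((1 + q ^ (k + 1)) ^ 2 - (1 - q) * x ^ 2 * q ^ (k + 1))) (by linear_combination hAB)] at hs
    rw [hinv.tprod_eq]
    simpa only [productSeriesTerm_eq hq] using hs
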